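/- Let $A\in\mathbb R^{n\times n}$, $B\in\mathbb R^{n\times m}$, $Q,Q_f\succeq 0$ in $\mathbb R^{n\times n}$ and $R\succ 0$ in $\mathbb R^{m\times m}$, with $(A,B)$ and $(A^\top,Q)$ stabilizable (a pair $(A,B)$ is stabilizable if $\rho(A-BK_0)<1$ for some matrix $K_0$). For an initial state $x_0$, a horizon $T$ and disturbances $w_0,\dots,w_{T-1}$ with $\|w_t\|\le r$, consider the system $x_{t+1}=Ax_t+Bu_t+w_t$ with cost $$J=\sum_{t=0}^{T-1}\left(x_t^\top Qx_t+u_t^\top Ru_t\right)+x_T^\top Q_fx_T .$$ Let $\mathrm{Opt}$ be the least cost over all control sequences $u_0,\dots,u_{T-1}$, chosen with full knowledge of the disturbances. Let $P\succeq 0$ be the solution of the Riccati equation $$P=Q+A^\top PA-A^\top PB(R+B^\top PB)^{-1}B^\top PA,$$ and put $K=(R+B^\top PB)^{-1}B^\top PA$, $F=A-BK$, $H=B(R+B^\top PB)^{-1}B^\top$. Assume that $P$ is invertible and that $\lambda_{\min}(P^{-1}-FP^{-1}F^\top-H)\neq 0$ (both hold whenever $Q\succ 0$). Let $k\ge 0$.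 The myopic predictive policy with $k$ exact predictions and no delay observes, at each time $t<T$, the state $x_t$ and the next $k$ disturbances $w_t,\dots,w_{t+k-1}$ (where $w_s=0$ for $s\ge T$). If $k\ge1$, it minimizes $$\sum_{i=t}^{t+k-1}\left(y_i^\top Qy_i+v_i^\top Rv_i\right)+y_{t+k}^\top Py_{t+k}\quad\text{subject to } y_t=x_t,\ y_{i+1}=Ay_i+Bv_i+w_i$$ over $v_t,\dots,v_{t+k-1}$ and applies $u_t=v_t$. If $k=0$, it applies $u_t=-Kx_t$. Let $\mathrm{Alg}$ be the cost $J$ of this policy. Then: 1. The policy is well defined: for all $k$, every state and all predicted disturbances, there is exactly one such action $u_t$. 2. There is a constant $\kappa$, depending only on $A,B,Q,R,Q_f,P,x_0$ and $r$ (not on $T$, $k$ or the disturbances), such that for all $k$ and $T$ and all (possibly adaptively chosen) disturbances with $\|w_t\|\le r$, $$\mathrm{Alg}\le\left[1+\frac{\|F^k\|^2\|H\|}{\lambda_{\min}(P^{-1}-FP^{-1}F^\top-H)}\right]\mathrm{Opt}+\kappa .$$ If $Q_f=P$, one can take $\kappa=0$. 3. The bound on the competitive ratio decays to $1$ exponentially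 in $k$: there are constants $C$ and $q\in(0,1)$, independent of $k$, such that for all $k\ge 0$ $$0\le\frac{\|F^k\|^2\|H\|}{\lambda_{\min}(P^{-1}-FP^{-1}F^\top-H)}\le C\,q^k .$$ Here $\rho$ is the spectral radius, $\lambda_{\min}$ the smallest eigenvalue, and $\|\cdot\|$ the Euclidean norm of a vector or the spectral norm of a matrix. -/

import Mathlib

open scoped Matrix Matrix.Norms.L2Operator ENNReal

noncomputable section

/-- The data of a finite-horizon linear quadratic regulator problem with state space `ℝⁿ` and
control space `ℝᵐ`: dynamics `x (t+1) = A x t + B u t + w t`, stage cost `xᵀ Q x + uᵀ R u`,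
terminal cost `xᵀ Qf x`. -/
structure LQR (n m : ℕ) where
  A : Matrix (Fin n) (Fin n) ℝ
  B : Matrix (Fin n) (Fin m) ℝ
  Q : Matrix (Fin n) (Fin n) ℝ
  R : Matrix (Fin m) (Fin m) ℝ
  Qf : Matrix (Fin n) (Fin n) ℝ

/-- Spectral radius of a real square matrix (largest modulus of a complex eigenvalue). -/
def realSpectralRadius {n : ℕ} (M : Matrix (Fin n) (Fin n) ℝ) : ℝ≥0∞ :=
  spectralRadius ℂ (M.map (algebraMap ℝ ℂ))

/-- `(A, B)` is stabilizable: some linear feedback `u = - K x` makes the closed loop stable. -/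
def IsStabilizable {n m : ℕ} (A : Matrix (Fin n) (Fin n) ℝ) (B : Matrix (Fin n) (Fin m) ℝ) :
    Prop :=
  ∃ K : Matrix (Fin m) (Fin n) ℝ, realSpectralRadius (A - B * K) < 1

/-- The smallest eigenvalue of a (symmetric) real matrix. -/
def lambdaMin {n : ℕ} (M : Matrix (Fin n) (Fin n) ℝ) : ℝ :=
  sInf (spectrum ℝ M)

namespace LQR

variable {n m : ℕ}

/-- Standing assumptions on the system. -/
structure Standing (S : LQR n m) : Prop where
  posSemidef_Q : S.Q.PosSemidef
  posSemidef_Qf : S.Qf.PosSemidef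
  posDef_R : S.R.PosDef
  stabilizable : IsStabilizable S.A S.B
  stabilizable_transpose : IsStabilizable S.Aᵀ S.Q

/-- `P` is the (positive semidefinite) solution of the discrete algebraic Riccati equation. -/
structure IsRiccatiSolution (S : LQR n m) (P : Matrix (Fin n) (Fin n) ℝ) : Prop where
  posSemidef : P.PosSemidef
  eq : P = S.Q + S.Aᵀ * P * S.A
    - S.Aᵀ * P * S.B * (S.R + S.Bᵀ * P * S.B)⁻¹ * S.Bᵀ * P * S.A

/-- The feedback gain `K = (R + Bᵀ P B)⁻¹ Bᵀ P A`. -/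
def gain (S : LQR n m) (P : Matrix (Fin n) (Fin n) ℝ) : Matrix (Fin m) (Fin n) ℝ :=
  (S.R + S.Bᵀ * P * S.B)⁻¹ * S.Bᵀ * P * S.A

/-- The closed-loop matrix `F = A - B K`. -/
def closedLoop (S : LQR n m) (P : Matrix (Fin n) (Fin n) ℝ) : Matrix (Fin n) (Fin n) ℝ :=
  S.A - S.B * S.gain P

/-- The matrix `H = B (R + Bᵀ P B)⁻¹ Bᵀ`. -/
def matH (S : LQR n m) (P : Matrix (Fin n) (Fin n) ℝ) : Matrix (Fin n) (Fin n) ℝ :=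
  S.B * (S.R + S.Bᵀ * P * S.B)⁻¹ * S.Bᵀ

/-- `∑_{t < N} (x_tᵀ Q x_t + u_tᵀ R u_t) + x_Nᵀ E x_N`, the cost over `N` steps with terminal
cost matrix `E`. -/
def costWith (S : LQR n m) (E : Matrix (Fin n) (Fin n) ℝ) (N : ℕ)
    (x : ℕ → Fin n → ℝ) (u : ℕ → Fin m → ℝ) : ℝ :=
  ∑ t ∈ Finset.range N, (x t ⬝ᵥ (S.Q *ᵥ x t) + u t ⬝ᵥ (S.R *ᵥ u t)) + x N ⬝ᵥ (E *ᵥ x N)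

/-- The cost `J` of the problem with horizon `T`. -/
def cost (S : LQR n m) (T : ℕ) (x : ℕ → Fin n → ℝ) (u : ℕ → Fin m → ℝ) : ℝ :=
  S.costWith S.Qf T x u

/-- The states reached from `x₀` under the controls `u` and the disturbances `w`. -/
def states (S : LQR n m) (x₀ : Fin n → ℝ) (u : ℕ → Fin m → ℝ) (w : ℕ → Fin n → ℝ) :
    ℕ → Fin n → ℝ
  | 0 => x₀
  | t + 1 => S.A *ᵥ states S x₀ u w t + S.B *ᵥ u t + w t

/-- The optimal offline cost: the least cost over all control sequences, chosen with full
knowledge of the disturbances `w`. -/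
def opt (S : LQR n m) (T : ℕ) (x₀ : Fin n → ℝ) (w : ℕ → Fin n → ℝ) : ℝ :=
  ⨅ u : ℕ → Fin m → ℝ, S.cost T (S.states x₀ u w) u

/-- `u` is an action of the myopic predictive policy with `k` predictions in state `x`, where
`what i` is the prediction of the disturbance `i` steps ahead. For `k ≥ 1`, it is the first action
of a minimizer of the `k`-step problem with terminal cost matrix `P` and disturbances `what`.
For `k = 0` nothing is predicted and the policy is the linear feedback `u = - K x`. -/
def IsMyopicAction (S : LQR n m) (P : Matrix (Fin n) (Fin n) ℝ) :
    (k : ℕ) → (x : Fin n → ℝ) → (what : ℕ → Fin n → ℝ) → (u : Fin m → ℝ) → Prop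
  | 0, x, _, u => u = -(S.gain P *ᵥ x)
  | k + 1, x, what, u =>
      ∃ v : ℕ → Fin m → ℝ, v 0 = u ∧
        ∀ v' : ℕ → Fin m → ℝ,
          S.costWith P (k + 1) (S.states x v what) v
            ≤ S.costWith P (k + 1) (S.states x v' what) v'

/-- The predictions available at time `t` when there are `k` exact predictions and no delay:
`what_{t+i|t} = w_{t+i}` for `i < k`, and zero otherwise. There are no disturbances at or after
the horizon `T`, so the prediction is zero there as well. -/
def exactPrediction (k T : ℕ) (w : ℕ → Fin n → ℝ) (t : ℕ) : ℕ → Fin n → ℝ :=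
  fun i => if i < k ∧ t + i < T then w (t + i) else 0

/-- `x`, `u` is a run over the horizon `T` of the myopic policy with `k` exact predictions and
without delay, started in `x₀` and with disturbances `w`. -/
structure IsMyopicRun (S : LQR n m) (P : Matrix (Fin n) (Fin n) ℝ) (k T : ℕ) (x₀ : Fin n → ℝ)
    (w : ℕ → Fin n → ℝ) (x : ℕ → Fin n → ℝ) (u : ℕ → Fin m → ℝ) : Prop where
  init : x 0 = x₀
  step : ∀ t < T, x (t + 1) = S.A *ᵥ x t + S.B *ᵥ u t + w t
  action : ∀ t < T, S.IsMyopicAction P k (x t) (exactPrediction k T w t) (u t)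

/-- `λ_min (P⁻¹ - F P⁻¹ Fᵀ - H)`. -/
def ratioDenom (S : LQR n m) (P : Matrix (Fin n) (Fin n) ℝ) : ℝ :=
  lambdaMin (P⁻¹ - S.closedLoop P * P⁻¹ * (S.closedLoop P)ᵀ - S.matH P)

/-- `‖F ^ k‖² ‖H‖ / λ_min (P⁻¹ - F P⁻¹ Fᵀ - H)`, with spectral norms: the excess of the competitive
ratio bound over one. -/
def ratioExcess (S : LQR n m) (P : Matrix (Fin n) (Fin n) ℝ) (k : ℕ) : ℝ :=
  ‖S.closedLoop P ^ k‖ ^ 2 * ‖S.matH P‖ / S.ratioDenom P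

end LQR

end

/-! Write Σ = R + BᵀPB, M = P⁻¹ − FP⁻¹Fᵀ − H and ψ_t = ∑_i (Fᵀ)^i P w_{t+i}. Completing squares at
each stage (`stageCost_add_potential`) and telescoping gives, for terminal matrix P and any
controls, cost = V(x₀, ψ₀) + ∑ ψ_tᵀ M ψ_t + ∑ d_tᵀ Σ d_t, where V ≥ 0 and d_t = u_t + K x_t +
Σ⁻¹Bᵀψ_t. The first two terms do not depend on the controls, so they form the optimum, attained
exactly when every d_t vanishes.

Applied to the window of k predictions, the same identity shows that the myopic policy uses this
optimal feedback with ψ_t cut after k terms. Its d_t is therefore Σ⁻¹Bᵀ(Fᵀ)^k ψ_{t+k}, and its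
excess cost is at most ‖H‖‖F^k‖² ∑‖ψ_t‖². The optimum is at least λ_min(M) ∑‖ψ_t‖²; M is positive
semidefinite, so λ_min(M) ≠ 0 means λ_min(M) > 0. Dividing yields the ratio for Q_f = P
(`IsMyopicRun.costWith_le`).

For general Q_f, detectability makes F exponentially stable, so the final states of the myopic run
and of the P-optimal trajectory are uniformly bounded. An arbitrary competitor may end far away, but
detectability makes it pay for this in stage cost (`exists_riccatiOpt_le_cost_add`). Changing the
terminal matrix thus costs only a constant. Stability of F also gives the exponential decay. -/

/-! ### The Euclidean norm on `Fin n → ℝ` -/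

/-- The Euclidean norm of a vector. -/
noncomputable def euNorm {n : ℕ} (x : Fin n → ℝ) : ℝ := ‖WithLp.toLp 2 x‖

section EuNorm

variable {n m : ℕ}

theorem euNorm_nonneg (x : Fin n → ℝ) : 0 ≤ euNorm x := norm_nonneg _

theorem euNorm_zero : euNorm (0 : Fin n → ℝ) = 0 := by simp [euNorm]

theorem euNorm_add_le (x y : Fin n → ℝ) : euNorm (x + y) ≤ euNorm x + euNorm y := by
  simpa [euNorm] using norm_add_le (WithLp.toLp 2 x) (WithLp.toLp 2 y)

theorem euNorm_neg (x : Fin n → ℝ) : euNorm (-x) = euNorm x := by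
  simp [euNorm]

theorem euNorm_sum_le {ι : Type*} (s : Finset ι) (f : ι → Fin n → ℝ) :
    euNorm (∑ i ∈ s, f i) ≤ ∑ i ∈ s, euNorm (f i) :=
  Finset.le_sum_of_subadditive euNorm euNorm_zero.le euNorm_add_le s f

theorem euNorm_mulVec_le (M : Matrix (Fin n) (Fin m) ℝ) (x : Fin m → ℝ) :
    euNorm (M *ᵥ x) ≤ ‖M‖ * euNorm x :=
  Matrix.l2_opNorm_mulVec M (WithLp.toLp 2 x)

theorem dotProduct_self_eq_euNorm_sq (x : Fin n → ℝ) : x ⬝ᵥ x = euNorm x ^ 2 := by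
  have h := EuclideanSpace.inner_toLp_toLp (𝕜 := ℝ) x x
  rw [star_trivial] at h
  rw [← h, euNorm, real_inner_self_eq_norm_sq]

theorem abs_dotProduct_le (x y : Fin n → ℝ) : |x ⬝ᵥ y| ≤ euNorm x * euNorm y := by
  have h := EuclideanSpace.inner_toLp_toLp (𝕜 := ℝ) y x
  rw [star_trivial] at h
  rw [← h, mul_comm]
  exact abs_real_inner_le_norm _ _

theorem abs_dotProduct_mulVec_le (M : Matrix (Fin n) (Fin m) ℝ) (x : Fin n → ℝ) (y : Fin m → ℝ) :
    |x ⬝ᵥ (M *ᵥ y)| ≤ ‖M‖ * euNorm x * euNorm y := by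
  calc |x ⬝ᵥ (M *ᵥ y)| ≤ euNorm x * euNorm (M *ᵥ y) := abs_dotProduct_le _ _
    _ ≤ euNorm x * (‖M‖ * euNorm y) := by
        gcongr
        · exact euNorm_nonneg x
        · exact euNorm_mulVec_le M y
    _ = _ := by ring

theorem norm_transpose (M : Matrix (Fin n) (Fin m) ℝ) : ‖Mᵀ‖ = ‖M‖ := by
  rw [← Matrix.conjTranspose_eq_transpose_of_trivial, Matrix.l2_opNorm_conjTranspose]

theorem mulVec_dotProduct (M : Matrix (Fin n) (Fin m) ℝ) (x : Fin m → ℝ) (y : Fin n → ℝ) :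
    (M *ᵥ x) ⬝ᵥ y = x ⬝ᵥ (Mᵀ *ᵥ y) := by
  rw [Matrix.dotProduct_mulVec, Matrix.vecMul_transpose]

theorem dotProduct_mulVec_comm_of_transpose (M : Matrix (Fin n) (Fin m) ℝ) (x : Fin n → ℝ)
    (y : Fin m → ℝ) : x ⬝ᵥ (M *ᵥ y) = y ⬝ᵥ (Mᵀ *ᵥ x) := by
  rw [dotProduct_comm, mulVec_dotProduct]

open scoped MatrixOrder in
/-- A positive semidefinite form controls the norm of its matrix applied to a vector. -/
theorem euNorm_mulVec_sq_le {M : Matrix (Fin n) (Fin n) ℝ} (hM : M.PosSemidef) :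
    ∃ c : ℝ, 0 ≤ c ∧ ∀ x, euNorm (M *ᵥ x) ^ 2 ≤ c * (x ⬝ᵥ (M *ᵥ x)) := by
  -- With M = DᵀD, the form at x is ‖Dx‖², while Mx = Dᵀ(Dx).
  obtain ⟨D, rfl⟩ : ∃ D : Matrix (Fin n) (Fin n) ℝ, M = Dᴴ * D :=
    CStarAlgebra.nonneg_iff_eq_star_mul_self.1 hM.nonneg
  refine ⟨‖Dᵀ‖ ^ 2, by positivity, fun x => ?_⟩
  have h : x ⬝ᵥ ((Dᴴ * D) *ᵥ x) = euNorm (D *ᵥ x) ^ 2 := by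
    rw [← dotProduct_self_eq_euNorm_sq, mulVec_dotProduct, Matrix.mulVec_mulVec,
      Matrix.conjTranspose_eq_transpose_of_trivial]
  rw [h, ← mul_pow, ← Matrix.mulVec_mulVec, Matrix.conjTranspose_eq_transpose_of_trivial]
  exact pow_le_pow_left₀ (euNorm_nonneg _) (euNorm_mulVec_le _ _) 2

theorem lambdaMin_nonneg {M : Matrix (Fin n) (Fin n) ℝ} (hM : M.PosSemidef) : 0 ≤ lambdaMin M :=
  Real.sInf_nonneg (Matrix.posSemidef_iff_isHermitian_and_spectrum_nonneg.1 hM).2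

/-- Subtracting λ_min times the identity shifts the spectrum into [0, ∞), so the difference is again
positive semidefinite. -/
theorem lambdaMin_mul_sq_le {M : Matrix (Fin n) (Fin n) ℝ} (hM : M.PosSemidef) (x : Fin n → ℝ) :
    lambdaMin M * euNorm x ^ 2 ≤ x ⬝ᵥ (M *ᵥ x) := by
  have hspec := (Matrix.posSemidef_iff_isHermitian_and_spectrum_nonneg.1 hM).2
  have hpsd : (M - algebraMap ℝ _ (lambdaMin M)).PosSemidef := by
    refine Matrix.posSemidef_iff_isHermitian_and_spectrum_nonneg.2 ⟨hM.1.sub ?_, ?_⟩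
    · rw [Matrix.algebraMap_eq_diagonal]
      exact Matrix.isHermitian_diagonal _
    · rw [← spectrum.sub_singleton_eq]
      rintro _ ⟨a, ha, b, rfl, rfl⟩
      exact sub_nonneg.2 (csInf_le ⟨0, hspec⟩ ha)
  have h := hpsd.dotProduct_mulVec_nonneg x
  rw [star_trivial, Matrix.sub_mulVec, dotProduct_sub, Algebra.algebraMap_eq_smul_one,
    Matrix.smul_mulVec, Matrix.one_mulVec, dotProduct_smul, dotProduct_self_eq_euNorm_sq,
    smul_eq_mul] at h
  linarith

end EuNorm

/-! ### Exponential stability -/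

section Stability

variable {n : ℕ}

/-- Real vectors embed isometrically into complex ones. This transfers bounds on powers from ℂ,
where Gelfand's formula applies. -/
theorem norm_le_norm_map_complex (M : Matrix (Fin n) (Fin n) ℝ) :
    ‖M‖ ≤ ‖M.map (algebraMap ℝ ℂ)‖ := by
  rw [Matrix.l2_opNorm_def]
  refine ContinuousLinearMap.opNorm_le_bound _ (norm_nonneg _) fun x => ?_
  have h := Matrix.l2_opNorm_mulVec (M.map (algebraMap ℝ ℂ))
    (WithLp.toLp 2 fun i => ((x i : ℝ) : ℂ))
  have h2 : (M.map (algebraMap ℝ ℂ)) *ᵥ (fun i => ((x i : ℝ) : ℂ))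
      = fun i => (((M *ᵥ x.ofLp) i : ℝ) : ℂ) := by
    ext i
    simp [Matrix.mulVec, dotProduct]
  have h3 : ∀ y : Fin n → ℝ, ‖(WithLp.toLp 2 fun i => ((y i : ℝ) : ℂ))‖ = ‖WithLp.toLp 2 y‖ := by
    intro y
    simp [EuclideanSpace.norm_eq]
  simp only [h2] at h
  have h4 := (h3 (M *ᵥ x.ofLp)).symm.le.trans h
  rw [h3] at h4
  exact h4

theorem exists_norm_pow_le_of_realSpectralRadius_lt_one {M : Matrix (Fin n) (Fin n) ℝ}
    (h : realSpectralRadius M < 1) :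
    ∃ c ρ : ℝ, 0 ≤ c ∧ 0 < ρ ∧ ρ < 1 ∧ ∀ k, ‖M ^ k‖ ≤ c * ρ ^ k := by
  set a := M.map (algebraMap ℝ ℂ) with ha
  obtain ⟨ρ, hρ, hρ1⟩ := ENNReal.lt_iff_exists_nnreal_btwn.1 h
  have hρ0 : (0 : ℝ) < ρ := by
    have : (0 : ℝ≥0∞) < ρ := bot_le.trans_lt hρ
    exact_mod_cast this
  have hlim := spectrum.pow_norm_pow_one_div_tendsto_nhds_spectralRadius a
  have hev := hlim.eventually_lt_const hρ
  obtain ⟨N, hN⟩ := Filter.eventually_atTop.1 hev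
  have hpow : ∀ k, ‖M ^ k‖ ≤ ‖a ^ k‖ := by
    intro k
    have : a ^ k = (M ^ k).map (algebraMap ℝ ℂ) := by
      rw [ha]
      exact (map_pow (algebraMap ℝ ℂ).mapMatrix M k).symm
    rw [this]
    exact norm_le_norm_map_complex _
  have hbig : ∀ k, N + 1 ≤ k → ‖a ^ k‖ ≤ (ρ : ℝ) ^ k := by
    intro k hk
    have h1 := hN k (by omega)
    rw [← ENNReal.ofReal_coe_nnreal, ENNReal.ofReal_lt_ofReal_iff hρ0] at h1
    have hk0 : k ≠ 0 := by omega
    calc ‖a ^ k‖ = (‖a ^ k‖ ^ (1 / (k : ℝ))) ^ k := by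
          rw [one_div, Real.rpow_inv_natCast_pow (norm_nonneg _) hk0]
      _ ≤ (ρ : ℝ) ^ k := pow_le_pow_left₀ (by positivity) h1.le k
  -- Gelfand's formula gives the bound ρ^k only for large k. The sum absorbs the finitely many
  -- remaining powers.
  refine ⟨1 + ∑ j ∈ Finset.range (N + 1), ‖a ^ j‖ / (ρ : ℝ) ^ j, ρ, by positivity, hρ0,
    by exact_mod_cast hρ1, fun k => (hpow k).trans ?_⟩
  by_cases hk : N + 1 ≤ k
  · refine (hbig k hk).trans (le_mul_of_one_le_left (by positivity) ?_)
    have : 0 ≤ ∑ j ∈ Finset.range (N + 1), ‖a ^ j‖ / (ρ : ℝ) ^ j := by positivity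
    linarith
  · have h1 : ‖a ^ k‖ / (ρ : ℝ) ^ k ≤ ∑ j ∈ Finset.range (N + 1), ‖a ^ j‖ / (ρ : ℝ) ^ j :=
      Finset.single_le_sum (f := fun j => ‖a ^ j‖ / (ρ : ℝ) ^ j) (fun j _ => by positivity)
        (Finset.mem_range.2 (by omega))
    rw [← div_le_iff₀ (by positivity)]
    linarith

/-- Convergence on basis vectors gives M^k → 0, so some power has norm below 1; the spectral radius
to that power is at most this norm. -/
theorem realSpectralRadius_lt_one_of_tendsto {M : Matrix (Fin n) (Fin n) ℝ}
    (h : ∀ x, Filter.Tendsto (fun k => M ^ k *ᵥ x) Filter.atTop (nhds 0)) :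
    realSpectralRadius M < 1 := by
  rcases isEmpty_or_nonempty (Fin n) with hn | hn
  · rw [realSpectralRadius, spectrum.SpectralRadius.of_subsingleton]
    exact zero_lt_one
  set a := M.map (algebraMap ℝ ℂ) with ha
  have hM : Filter.Tendsto (fun k => M ^ k) Filter.atTop (nhds 0) := by
    refine tendsto_pi_nhds.2 fun i => tendsto_pi_nhds.2 fun j => ?_
    have := (tendsto_pi_nhds.1 (h (Pi.single j 1))) i
    simpa using this
  have hmap : ∀ k, a ^ k = (M ^ k).map (algebraMap ℝ ℂ) := fun k => by
    rw [ha]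
    exact (map_pow (algebraMap ℝ ℂ).mapMatrix M k).symm
  have ha0 : Filter.Tendsto (fun k => a ^ k) Filter.atTop (nhds 0) := by
    simp only [hmap]
    have hc : Continuous fun X : Matrix (Fin n) (Fin n) ℝ => X.map (algebraMap ℝ ℂ) :=
      Continuous.matrix_map continuous_id (by fun_prop)
    have := (hc.tendsto 0).comp hM
    simpa [Function.comp_def] using this
  have hn0 : Filter.Tendsto (fun k => ‖a ^ k‖) Filter.atTop (nhds 0) := by
    simpa using ha0.norm
  obtain ⟨k, hk1, hk⟩ :=
    ((hn0.eventually_lt_const zero_lt_one).and (Filter.eventually_ge_atTop 1)).exists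
  have h1 := (spectrum.spectralRadius_pow_le a k (by omega)).trans
    (spectrum.spectralRadius_le_nnnorm (𝕜 := ℂ) (a ^ k))
  by_contra hcon
  have h2 : (1 : ℝ≥0∞) ≤ spectralRadius ℂ a ^ k := one_le_pow₀ (not_lt.1 hcon)
  have h3 : (1 : ℝ≥0∞) ≤ ‖a ^ k‖₊ := h2.trans h1
  have h4 : (1 : ℝ) ≤ ‖a ^ k‖ := by exact_mod_cast h3
  linarith

theorem affine_recursion_eq {G : Matrix (Fin n) (Fin n) ℝ} {e a : ℕ → Fin n → ℝ} (N : ℕ)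
    (h : ∀ t < N, e (t + 1) = G *ᵥ e t + a t) :
    e N = G ^ N *ᵥ e 0 + ∑ j ∈ Finset.range N, G ^ j *ᵥ a (N - 1 - j) := by
  induction N with
  | zero => simp
  | succ N ih =>
    rw [h N (by omega), ih fun t ht => h t (by omega), Finset.sum_range_succ', Matrix.mulVec_add,
      Matrix.mulVec_mulVec, ← pow_succ', Matrix.mulVec_sum, add_assoc]
    congr 2
    · refine Finset.sum_congr rfl fun j _ => ?_
      rw [Matrix.mulVec_mulVec, ← pow_succ']
      congr 2
      omega
    · simp

theorem geom_sum_le {ρ : ℝ} (h0 : 0 < ρ) (h1 : ρ < 1) (N : ℕ) :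
    ∑ j ∈ Finset.range N, ρ ^ j ≤ (1 - ρ)⁻¹ := by
  rw [← tsum_geometric_of_lt_one h0.le h1]
  exact (summable_geometric_of_lt_one h0.le h1).sum_le_tsum _ fun _ _ => by positivity

theorem euNorm_sum_pow_mulVec_le {G : Matrix (Fin n) (Fin n) ℝ} {c ρ b : ℝ} (hc : 0 ≤ c)
    (h0 : 0 < ρ) (h1 : ρ < 1) (hG : ∀ k, ‖G ^ k‖ ≤ c * ρ ^ k) (hb : 0 ≤ b) {N : ℕ}
    {f : ℕ → Fin n → ℝ} (hf : ∀ j < N, euNorm (f j) ≤ b) :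
    euNorm (∑ j ∈ Finset.range N, G ^ j *ᵥ f j) ≤ c * b * (1 - ρ)⁻¹ := by
  calc euNorm (∑ j ∈ Finset.range N, G ^ j *ᵥ f j)
      ≤ ∑ j ∈ Finset.range N, euNorm (G ^ j *ᵥ f j) := euNorm_sum_le _ _
    _ ≤ ∑ j ∈ Finset.range N, c * ρ ^ j * b := by
        refine Finset.sum_le_sum fun j hj => (euNorm_mulVec_le _ _).trans ?_
        exact mul_le_mul (hG j) (hf j (Finset.mem_range.1 hj)) (euNorm_nonneg _) (by positivity)
    _ = c * b * ∑ j ∈ Finset.range N, ρ ^ j := by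
        rw [Finset.mul_sum]
        exact Finset.sum_congr rfl fun j _ => by ring
    _ ≤ _ := by
        gcongr
        exact geom_sum_le h0 h1 N

theorem euNorm_affine_recursion_le {G : Matrix (Fin n) (Fin n) ℝ} {c ρ b : ℝ} (hc : 0 ≤ c)
    (h0 : 0 < ρ) (h1 : ρ < 1) (hG : ∀ k, ‖G ^ k‖ ≤ c * ρ ^ k) (hb : 0 ≤ b)
    {e a : ℕ → Fin n → ℝ} {N : ℕ} (h : ∀ t < N, e (t + 1) = G *ᵥ e t + a t)
    (ha : ∀ t < N, euNorm (a t) ≤ b) :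
    euNorm (e N) ≤ c * euNorm (e 0) + c * b * (1 - ρ)⁻¹ := by
  rw [affine_recursion_eq N h]
  refine (euNorm_add_le _ _).trans (add_le_add ((euNorm_mulVec_le _ _).trans ?_) ?_)
  · refine mul_le_mul_of_nonneg_right ((hG N).trans ?_) (euNorm_nonneg _)
    exact mul_le_of_le_one_right hc (pow_le_one₀ h0.le h1.le)
  · exact euNorm_sum_pow_mulVec_le hc h0 h1 hG hb fun j hj => ha _ (by omega)

/-- Cauchy–Schwarz applied to the convolution of the geometric kernel with the inputs. The constant
does not depend on `N`. -/
theorem euNorm_affine_recursion_sq_le {G : Matrix (Fin n) (Fin n) ℝ} {c ρ : ℝ}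
    (h0 : 0 < ρ) (h1 : ρ < 1) (hG : ∀ k, ‖G ^ k‖ ≤ c * ρ ^ k)
    {e a : ℕ → Fin n → ℝ} {N : ℕ} (h : ∀ t < N, e (t + 1) = G *ᵥ e t + a t) (he : e 0 = 0) :
    euNorm (e N) ^ 2 ≤ c ^ 2 * (1 - ρ)⁻¹ * ∑ t ∈ Finset.range N, euNorm (a t) ^ 2 := by
  have hle : euNorm (e N) ≤ c * ∑ j ∈ Finset.range N, ρ ^ j * euNorm (a (N - 1 - j)) := by
    rw [affine_recursion_eq N h, he, Matrix.mulVec_zero, zero_add, Finset.mul_sum]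
    refine (euNorm_sum_le _ _).trans (Finset.sum_le_sum fun j _ => ?_)
    rw [← mul_assoc]
    exact (euNorm_mulVec_le _ _).trans (mul_le_mul_of_nonneg_right (hG j) (euNorm_nonneg _))
  have hsq : ∑ j ∈ Finset.range N, (ρ ^ j) ^ 2 ≤ (1 - ρ)⁻¹ := by
    refine le_trans (Finset.sum_le_sum fun j _ => ?_) (geom_sum_le h0 h1 N)
    exact pow_le_of_le_one (by positivity) (pow_le_one₀ h0.le h1.le) two_ne_zero
  have hcs := Finset.sum_mul_sq_le_sq_mul_sq (Finset.range N) (fun j => ρ ^ j)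
    fun j => euNorm (a (N - 1 - j))
  rw [Finset.sum_range_reflect (fun t => euNorm (a t) ^ 2) N] at hcs
  calc euNorm (e N) ^ 2
      ≤ (c * ∑ j ∈ Finset.range N, ρ ^ j * euNorm (a (N - 1 - j))) ^ 2 :=
        pow_le_pow_left₀ (euNorm_nonneg _) hle 2
    _ = c ^ 2 * (∑ j ∈ Finset.range N, ρ ^ j * euNorm (a (N - 1 - j))) ^ 2 := by ring
    _ ≤ c ^ 2 * ((1 - ρ)⁻¹ * ∑ t ∈ Finset.range N, euNorm (a t) ^ 2) := by
        gcongr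
        exact hcs.trans (by gcongr)
    _ = _ := by ring

theorem tendsto_affine_recursion {G : Matrix (Fin n) (Fin n) ℝ} {c ρ : ℝ} (hc : 0 ≤ c)
    (h0 : 0 < ρ) (h1 : ρ < 1) (hG : ∀ k, ‖G ^ k‖ ≤ c * ρ ^ k)
    {e a : ℕ → Fin n → ℝ} (h : ∀ t, e (t + 1) = G *ᵥ e t + a t)
    (ha : Filter.Tendsto (fun t => euNorm (a t)) Filter.atTop (nhds 0)) :
    Filter.Tendsto (fun t => euNorm (e t)) Filter.atTop (nhds 0) := by
  have hρ := tendsto_pow_atTop_nhds_zero_of_lt_one h0.le h1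
  obtain ⟨b, hb⟩ := ha.bddAbove_range
  have hb' : ∀ t, euNorm (a t) ≤ b := fun t => hb ⟨t, rfl⟩
  -- Extending the convolution by zero turns it into a series over all j, dominated by a geometric
  -- one, whose terms each tend to 0 as N grows.
  set s : ℕ → ℕ → ℝ := fun N j => if j < N then c * ρ ^ j * euNorm (a (N - 1 - j)) else 0
  have hs : Filter.Tendsto (fun N => ∑' j, s N j) Filter.atTop (nhds (∑' _ : ℕ, (0 : ℝ))) := by
    refine tendsto_tsum_of_dominated_convergence (bound := fun j => c * ρ ^ j * b)
      (((summable_geometric_of_lt_one h0.le h1).mul_left c).mul_right b) (fun j => ?_)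
      (Filter.Eventually.of_forall fun N j => ?_)
    · have h2 : Filter.Tendsto (fun N => euNorm (a (N - 1 - j))) Filter.atTop (nhds 0) := by
        refine ha.comp ?_
        simp only [Nat.sub_sub]
        exact Filter.tendsto_sub_atTop_nat _
      have h3 : Filter.Tendsto (fun N => c * ρ ^ j * euNorm (a (N - 1 - j))) Filter.atTop
          (nhds 0) := by simpa using h2.const_mul (c * ρ ^ j)
      refine h3.congr' ?_
      filter_upwards [Filter.eventually_gt_atTop j] with N hN
      simp [s, hN]
    · have hb0 : 0 ≤ b := (euNorm_nonneg _).trans (hb' 0)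
      by_cases hj : j < N
      · simp only [s, hj, if_true]
        have := euNorm_nonneg (a (N - 1 - j))
        rw [Real.norm_of_nonneg (by positivity)]
        exact mul_le_mul_of_nonneg_left (hb' _) (by positivity)
      · simp only [s, hj, if_false, norm_zero]
        positivity
  have hs' : ∀ N, ∑' j, s N j = ∑ j ∈ Finset.range N, c * ρ ^ j * euNorm (a (N - 1 - j)) := by
    intro N
    rw [tsum_eq_sum (s := Finset.range N) fun j hj => by simp [s, Finset.mem_range.not.1 hj]]
    exact Finset.sum_congr rfl fun j hj => by simp [s, Finset.mem_range.1 hj]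
  have htot : Filter.Tendsto (fun N => c * ρ ^ N * euNorm (e 0) + ∑' j, s N j) Filter.atTop
      (nhds 0) := by
    simpa using ((hρ.const_mul c).mul_const (euNorm (e 0))).add hs
  refine squeeze_zero (fun t => euNorm_nonneg _) (fun N => ?_) htot
  rw [hs', affine_recursion_eq N fun t _ => h t]
  refine (euNorm_add_le _ _).trans (add_le_add ?_ ?_)
  · exact (euNorm_mulVec_le _ _).trans (mul_le_mul_of_nonneg_right (hG N) (euNorm_nonneg _))
  · refine (euNorm_sum_le _ _).trans (Finset.sum_le_sum fun j _ => ?_)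
    exact (euNorm_mulVec_le _ _).trans (mul_le_mul_of_nonneg_right (hG j) (euNorm_nonneg _))

end Stability

theorem quadForm_add {n : ℕ} {M : Matrix (Fin n) (Fin n) ℝ} (hM : Mᵀ = M) (a b : Fin n → ℝ) :
    (a + b) ⬝ᵥ (M *ᵥ (a + b)) = a ⬝ᵥ (M *ᵥ a) + 2 * (a ⬝ᵥ (M *ᵥ b)) + b ⬝ᵥ (M *ᵥ b) := by
  have h : b ⬝ᵥ (M *ᵥ a) = a ⬝ᵥ (M *ᵥ b) := by
    rw [dotProduct_mulVec_comm_of_transpose, hM]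
  rw [Matrix.mulVec_add, add_dotProduct, dotProduct_add, dotProduct_add, h]
  ring

theorem Matrix.PosSemidef.transpose_eq {n : ℕ} {M : Matrix (Fin n) (Fin n) ℝ}
    (hM : M.PosSemidef) : Mᵀ = M := by
  rw [← Matrix.conjTranspose_eq_transpose_of_trivial]
  exact hM.1

theorem Matrix.PosSemidef.quadForm_nonneg {n : ℕ} {M : Matrix (Fin n) (Fin n) ℝ}
    (hM : M.PosSemidef) (x : Fin n → ℝ) : 0 ≤ x ⬝ᵥ (M *ᵥ x) := by
  simpa using hM.dotProduct_mulVec_nonneg x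

/-! ### Completion of squares -/

namespace LQR

variable {n m : ℕ} {S : LQR n m} {P : Matrix (Fin n) (Fin n) ℝ}

/-- The matrix `R + Bᵀ P B` of the control in the one-step problem. -/
def gramSig (S : LQR n m) (P : Matrix (Fin n) (Fin n) ℝ) : Matrix (Fin m) (Fin m) ℝ :=
  S.R + S.Bᵀ * P * S.B

/-- The feedforward gain `(R + Bᵀ P B)⁻¹ Bᵀ`. -/
noncomputable def feedforward (S : LQR n m) (P : Matrix (Fin n) (Fin n) ℝ) :
    Matrix (Fin m) (Fin n) ℝ :=
  (S.gramSig P)⁻¹ * S.Bᵀ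

theorem Standing.posDef_gramSig (hS : S.Standing) (hP : P.PosSemidef) : (S.gramSig P).PosDef := by
  have h := hP.conjTranspose_mul_mul_same S.B
  rw [Matrix.conjTranspose_eq_transpose_of_trivial] at h
  exact hS.posDef_R.add_posSemidef h

theorem Standing.gramSig_mul_inv (hS : S.Standing) (hP : P.PosSemidef) :
    S.gramSig P * (S.gramSig P)⁻¹ = 1 :=
  Matrix.mul_nonsing_inv _ ((Matrix.isUnit_iff_isUnit_det _).1 (hS.posDef_gramSig hP).isUnit)

theorem Standing.gramSig_mul_feedforward (hS : S.Standing) (hP : P.PosSemidef) :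
    S.gramSig P * S.feedforward P = S.Bᵀ := by
  rw [feedforward, ← Matrix.mul_assoc, hS.gramSig_mul_inv hP, Matrix.one_mul]

theorem mul_feedforward : S.B * S.feedforward P = S.matH P := by
  rw [feedforward, matH, gramSig, ← Matrix.mul_assoc]

theorem Standing.posSemidef_matH (hS : S.Standing) (hP : P.PosSemidef) :
    (S.matH P).PosSemidef := by
  have h := (hS.posDef_gramSig hP).posSemidef.inv.conjTranspose_mul_mul_same S.Bᵀ
  rwa [Matrix.conjTranspose_eq_transpose_of_trivial, Matrix.transpose_transpose] at h

/-- The Riccati equation says exactly that minimizing over u the stage cost plus the P-form of the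
next state leaves xᵀPx; the remainder is a square around u = −Kx. -/
theorem IsRiccatiSolution.stageCost_add (hS : S.Standing) (hP : S.IsRiccatiSolution P)
    (x : Fin n → ℝ) (u : Fin m → ℝ) :
    x ⬝ᵥ (S.Q *ᵥ x) + u ⬝ᵥ (S.R *ᵥ u)
        + (S.A *ᵥ x + S.B *ᵥ u) ⬝ᵥ (P *ᵥ (S.A *ᵥ x + S.B *ᵥ u))
      = x ⬝ᵥ (P *ᵥ x) + (u + S.gain P *ᵥ x) ⬝ᵥ (S.gramSig P *ᵥ (u + S.gain P *ᵥ x)) := by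
  have hPt := hP.posSemidef.transpose_eq
  have hSt := (hS.posDef_gramSig hP.posSemidef).posSemidef.transpose_eq
  have hSK : S.gramSig P * S.gain P = S.Bᵀ * P * S.A := by
    have : S.gain P = S.feedforward P * P * S.A := by rw [gain, feedforward, gramSig]
    rw [this, ← Matrix.mul_assoc, ← Matrix.mul_assoc, hS.gramSig_mul_feedforward hP.posSemidef]
  have hKSK : (S.gain P)ᵀ * (S.gramSig P * S.gain P)
      = S.Aᵀ * P * S.B * (S.R + S.Bᵀ * P * S.B)⁻¹ * S.Bᵀ * P * S.A := by
    rw [hSK]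
    have : ((S.gramSig P)⁻¹)ᵀ = (S.gramSig P)⁻¹ := by rw [Matrix.transpose_nonsing_inv, hSt]
    have h2 : S.gain P = (S.gramSig P)⁻¹ * S.Bᵀ * P * S.A := rfl
    rw [h2, Matrix.transpose_mul, Matrix.transpose_mul, Matrix.transpose_mul, this, hPt,
      Matrix.transpose_transpose, gramSig]
    simp only [Matrix.mul_assoc]
  have e1 : (S.gain P *ᵥ x) ⬝ᵥ (S.gramSig P *ᵥ (S.gain P *ᵥ x))
      = x ⬝ᵥ (S.Q *ᵥ x) + (S.A *ᵥ x) ⬝ᵥ (P *ᵥ (S.A *ᵥ x)) - x ⬝ᵥ (P *ᵥ x) := by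
    have h := congrArg (fun M => x ⬝ᵥ (M *ᵥ x)) hP.eq
    rw [mulVec_dotProduct, mulVec_dotProduct, Matrix.mulVec_mulVec, Matrix.mulVec_mulVec,
      Matrix.mul_assoc, hKSK, Matrix.mulVec_mulVec, Matrix.mulVec_mulVec]
    simp only [Matrix.sub_mulVec, Matrix.add_mulVec, dotProduct_sub, dotProduct_add] at h
    linarith
  have e2 : u ⬝ᵥ (S.gramSig P *ᵥ (S.gain P *ᵥ x)) = (S.B *ᵥ u) ⬝ᵥ (P *ᵥ (S.A *ᵥ x)) := by
    rw [Matrix.mulVec_mulVec, hSK, mulVec_dotProduct]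
    simp only [Matrix.mulVec_mulVec, Matrix.mul_assoc]
  have e3 : u ⬝ᵥ (S.gramSig P *ᵥ u) = u ⬝ᵥ (S.R *ᵥ u) + (S.B *ᵥ u) ⬝ᵥ (P *ᵥ (S.B *ᵥ u)) := by
    rw [gramSig, Matrix.add_mulVec, dotProduct_add, mulVec_dotProduct]
    simp only [Matrix.mulVec_mulVec, Matrix.mul_assoc]
  rw [quadForm_add hSt, e1, e2, e3, add_comm (S.A *ᵥ x), quadForm_add hPt]
  ring

theorem closedLoop_mulVec_add (x : Fin n → ℝ) (u : Fin m → ℝ) :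
    S.A *ᵥ x + S.B *ᵥ u = S.closedLoop P *ᵥ x + S.B *ᵥ (u + S.gain P *ᵥ x) := by
  rw [closedLoop, Matrix.sub_mulVec, Matrix.mulVec_add, Matrix.mulVec_mulVec]
  abel

/-- The cost-to-go `(P x + Fᵀ ψ)ᵀ P⁻¹ (P x + Fᵀ ψ)` of the state `x` when `ψ` collects the
discounted future disturbances, up to a term that does not depend on `x`. -/
noncomputable def potential (S : LQR n m) (P : Matrix (Fin n) (Fin n) ℝ) (x ψ : Fin n → ℝ) : ℝ :=
  (P *ᵥ x + (S.closedLoop P)ᵀ *ᵥ ψ) ⬝ᵥ (P⁻¹ *ᵥ (P *ᵥ x + (S.closedLoop P)ᵀ *ᵥ ψ))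

/-- `P⁻¹ - F P⁻¹ Fᵀ - H`. -/
noncomputable def matM (S : LQR n m) (P : Matrix (Fin n) (Fin n) ℝ) : Matrix (Fin n) (Fin n) ℝ :=
  P⁻¹ - S.closedLoop P * P⁻¹ * (S.closedLoop P)ᵀ - S.matH P

/-- The deviation `u + K x + (R + Bᵀ P B)⁻¹ Bᵀ ψ` of a control from the optimal one. -/
noncomputable def deviation (S : LQR n m) (P : Matrix (Fin n) (Fin n) ℝ) (x ψ : Fin n → ℝ)
    (u : Fin m → ℝ) : Fin m → ℝ :=
  u + S.gain P *ᵥ x + S.feedforward P *ᵥ ψ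

theorem potential_nonneg (hP : P.PosSemidef) (x ψ : Fin n → ℝ) : 0 ≤ S.potential P x ψ :=
  hP.inv.quadForm_nonneg _

theorem quadForm_inv_add (hP : P.PosSemidef) (hPinv : IsUnit P.det) (y ψ : Fin n → ℝ) :
    (P *ᵥ y + ψ) ⬝ᵥ (P⁻¹ *ᵥ (P *ᵥ y + ψ))
      = y ⬝ᵥ (P *ᵥ y) + 2 * (y ⬝ᵥ ψ) + ψ ⬝ᵥ (P⁻¹ *ᵥ ψ) := by
  rw [quadForm_add hP.inv.transpose_eq, mulVec_dotProduct, mulVec_dotProduct, hP.transpose_eq]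
  simp only [Matrix.mulVec_mulVec]
  rw [Matrix.nonsing_inv_mul _ hPinv, Matrix.mul_one, Matrix.mul_nonsing_inv _ hPinv,
    Matrix.one_mulVec]

/-- Completion of squares over one step. -/
theorem IsRiccatiSolution.stageCost_add_potential (hS : S.Standing) (hP : S.IsRiccatiSolution P)
    (hPinv : IsUnit P.det) (x w ψ ψ' : Fin n → ℝ) (u : Fin m → ℝ)
    (hψ : ψ = P *ᵥ w + (S.closedLoop P)ᵀ *ᵥ ψ') :
    x ⬝ᵥ (S.Q *ᵥ x) + u ⬝ᵥ (S.R *ᵥ u) + S.potential P (S.A *ᵥ x + S.B *ᵥ u + w) ψ'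
      = S.potential P x ψ + ψ ⬝ᵥ (S.matM P *ᵥ ψ)
        + S.deviation P x ψ u ⬝ᵥ (S.gramSig P *ᵥ S.deviation P x ψ u) := by
  have hp := hP.posSemidef
  have hSt := (hS.posDef_gramSig hp).posSemidef.transpose_eq
  set g := u + S.gain P *ᵥ x with hg
  set y := S.A *ᵥ x + S.B *ᵥ u with hy
  have e1 := hP.stageCost_add hS x u
  -- The recursion for ψ folds the disturbance into it: P(y + w) + Fᵀψ' = Py + ψ.
  have e3 : S.potential P (y + w) ψ' = y ⬝ᵥ (P *ᵥ y) + 2 * (y ⬝ᵥ ψ) + ψ ⬝ᵥ (P⁻¹ *ᵥ ψ) := by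
    rw [potential, Matrix.mulVec_add, add_assoc, ← hψ, quadForm_inv_add hp hPinv]
  have e4 : y ⬝ᵥ ψ = x ⬝ᵥ ((S.closedLoop P)ᵀ *ᵥ ψ) + g ⬝ᵥ (S.Bᵀ *ᵥ ψ) := by
    rw [hy, closedLoop_mulVec_add (P := P), add_dotProduct, mulVec_dotProduct, mulVec_dotProduct]
  have e5 : S.deviation P x ψ u ⬝ᵥ (S.gramSig P *ᵥ S.deviation P x ψ u)
      = g ⬝ᵥ (S.gramSig P *ᵥ g) + 2 * (g ⬝ᵥ (S.Bᵀ *ᵥ ψ)) + ψ ⬝ᵥ (S.matH P *ᵥ ψ) := by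
    rw [deviation, ← hg, quadForm_add hSt, Matrix.mulVec_mulVec _ (S.gramSig P),
      hS.gramSig_mul_feedforward hp, dotProduct_comm (S.feedforward P *ᵥ ψ), mulVec_dotProduct,
      Matrix.transpose_transpose, Matrix.mulVec_mulVec, mul_feedforward]
  have e6 : S.potential P x ψ = x ⬝ᵥ (P *ᵥ x) + 2 * (x ⬝ᵥ ((S.closedLoop P)ᵀ *ᵥ ψ))
      + ψ ⬝ᵥ ((S.closedLoop P * P⁻¹ * (S.closedLoop P)ᵀ) *ᵥ ψ) := by
    rw [potential, quadForm_inv_add hp hPinv, mulVec_dotProduct ((S.closedLoop P)ᵀ),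
      Matrix.transpose_transpose]
    simp only [Matrix.mulVec_mulVec, Matrix.mul_assoc]
  have e7 : ψ ⬝ᵥ (S.matM P *ᵥ ψ) = ψ ⬝ᵥ (P⁻¹ *ᵥ ψ)
      - ψ ⬝ᵥ ((S.closedLoop P * P⁻¹ * (S.closedLoop P)ᵀ) *ᵥ ψ) - ψ ⬝ᵥ (S.matH P *ᵥ ψ) := by
    simp only [matM, Matrix.sub_mulVec, dotProduct_sub]
  linarith

/-- Any ψ can be isolated in the one-step identity: with w = P⁻¹ψ, ψ' = 0, x = −P⁻¹Fᵀψ and the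
optimal u, the potential at x and the deviation both vanish. Then ψᵀMψ equals a stage cost plus a
potential. -/
theorem IsRiccatiSolution.posSemidef_matM (hS : S.Standing) (hP : S.IsRiccatiSolution P)
    (hPinv : IsUnit P.det) : (S.matM P).PosSemidef := by
  have hp := hP.posSemidef
  refine Matrix.PosSemidef.of_dotProduct_mulVec_nonneg ?_ fun ψ => ?_
  · have hH : (S.matH P)ᴴ = S.matH P := (hS.posSemidef_matH hp).1
    have hI : (P⁻¹)ᵀ = P⁻¹ := hp.inv.transpose_eq
    rw [Matrix.conjTranspose_eq_transpose_of_trivial] at hH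
    rw [Matrix.IsHermitian, Matrix.conjTranspose_eq_transpose_of_trivial, matM]
    simp only [Matrix.transpose_sub, Matrix.transpose_mul, Matrix.transpose_transpose, hH, hI,
      Matrix.mul_assoc]
  · set x : Fin n → ℝ := -(P⁻¹ *ᵥ ((S.closedLoop P)ᵀ *ᵥ ψ)) with hx
    set u : Fin m → ℝ := -(S.gain P *ᵥ x) - S.feedforward P *ᵥ ψ with hu
    have h := hP.stageCost_add_potential hS hPinv x (P⁻¹ *ᵥ ψ) ψ 0 u (by
      rw [Matrix.mulVec_mulVec, Matrix.mul_nonsing_inv _ hPinv, Matrix.one_mulVec,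
        Matrix.mulVec_zero, add_zero])
    have h1 : S.potential P x ψ = 0 := by
      rw [potential, hx, Matrix.mulVec_neg, Matrix.mulVec_mulVec,
        Matrix.mul_nonsing_inv _ hPinv, Matrix.one_mulVec, neg_add_cancel, zero_dotProduct]
    have h2 : S.deviation P x ψ u = 0 := by
      rw [deviation, hu]
      abel
    rw [h1, h2, zero_dotProduct] at h
    rw [star_trivial]
    have h3 := S.potential_nonneg hp (S.A *ᵥ x + S.B *ᵥ u + P⁻¹ *ᵥ ψ) 0
    have h4 := hS.posSemidef_Q.quadForm_nonneg x
    have h5 := hS.posDef_R.posSemidef.quadForm_nonneg u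
    linarith

/-- Completion of squares over the horizon `N`. -/
theorem IsRiccatiSolution.costWith_eq (hS : S.Standing) (hP : S.IsRiccatiSolution P)
    (hPinv : IsUnit P.det) {x w ψ : ℕ → Fin n → ℝ} {u : ℕ → Fin m → ℝ} {N : ℕ}
    (hx : ∀ t < N, x (t + 1) = S.A *ᵥ x t + S.B *ᵥ u t + w t)
    (hψ : ∀ t < N, ψ t = P *ᵥ w t + (S.closedLoop P)ᵀ *ᵥ ψ (t + 1)) (hN : ψ N = 0) :
    S.costWith P N x u = S.potential P (x 0) (ψ 0)
      + ∑ t ∈ Finset.range N, ψ t ⬝ᵥ (S.matM P *ᵥ ψ t)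
      + ∑ t ∈ Finset.range N, S.deviation P (x t) (ψ t) (u t) ⬝ᵥ
          (S.gramSig P *ᵥ S.deviation P (x t) (ψ t) (u t)) := by
  have key : ∀ k ≤ N, ∑ t ∈ Finset.range k, (x t ⬝ᵥ (S.Q *ᵥ x t) + u t ⬝ᵥ (S.R *ᵥ u t))
      + S.potential P (x k) (ψ k) = S.potential P (x 0) (ψ 0)
      + ∑ t ∈ Finset.range k, ψ t ⬝ᵥ (S.matM P *ᵥ ψ t)
      + ∑ t ∈ Finset.range k, S.deviation P (x t) (ψ t) (u t) ⬝ᵥ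
          (S.gramSig P *ᵥ S.deviation P (x t) (ψ t) (u t)) := by
    intro k
    induction k with
    | zero => simp
    | succ k ih =>
      intro hk
      have h := hP.stageCost_add_potential hS hPinv (x k) (w k) (ψ k) (ψ (k + 1)) (u k)
        (hψ k (by omega))
      rw [← hx k (by omega)] at h
      have h2 := ih (by omega)
      simp only [Finset.sum_range_succ]
      linarith
  rw [← key N le_rfl, hN, costWith, potential, Matrix.mulVec_zero, add_zero, mulVec_dotProduct,
    hP.posSemidef.transpose_eq]
  simp only [Matrix.mulVec_mulVec]
  rw [Matrix.nonsing_inv_mul _ hPinv, Matrix.mul_one]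

end LQR

/-! ### The myopic policy as truncated optimal feedback -/

namespace LQR

variable {n m : ℕ} {S : LQR n m} {P : Matrix (Fin n) (Fin n) ℝ}

/-- The accumulated disturbances `∑_{i < N - t} (Fᵀ)^i P w_{t+i}`. -/
noncomputable def disturbanceSum (S : LQR n m) (P : Matrix (Fin n) (Fin n) ℝ) (N : ℕ)
    (w : ℕ → Fin n → ℝ) (t : ℕ) : Fin n → ℝ :=
  ∑ i ∈ Finset.range (N - t), (S.closedLoop P)ᵀ ^ i *ᵥ (P *ᵥ w (t + i))

theorem disturbanceSum_of_le {N t : ℕ} (h : N ≤ t) (w : ℕ → Fin n → ℝ) :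
    S.disturbanceSum P N w t = 0 := by
  simp [disturbanceSum, Nat.sub_eq_zero_of_le h]

theorem disturbanceSum_of_lt {N t : ℕ} (h : t < N) (w : ℕ → Fin n → ℝ) :
    S.disturbanceSum P N w t
      = P *ᵥ w t + (S.closedLoop P)ᵀ *ᵥ S.disturbanceSum P N w (t + 1) := by
  rw [disturbanceSum, disturbanceSum, show N - t = N - (t + 1) + 1 by omega,
    Finset.sum_range_succ', Matrix.mulVec_sum, add_comm]
  congr 1
  · simp
  · refine Finset.sum_congr rfl fun i _ => ?_
    rw [Matrix.mulVec_mulVec _ (S.closedLoop P)ᵀ, ← pow_succ',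
      show t + (i + 1) = t + 1 + i by omega]

/-- Splitting off the first `k` of the accumulated disturbances. -/
theorem disturbanceSum_eq_add (k T : ℕ) (w : ℕ → Fin n → ℝ) (t : ℕ) :
    S.disturbanceSum P T w t = S.disturbanceSum P k (exactPrediction k T w t) 0
      + (S.closedLoop P)ᵀ ^ k *ᵥ S.disturbanceSum P T w (t + k) := by
  have h : ∀ j ≤ k, S.disturbanceSum P T w t
      = ∑ i ∈ Finset.range j, (S.closedLoop P)ᵀ ^ i *ᵥ (P *ᵥ exactPrediction k T w t i)
        + (S.closedLoop P)ᵀ ^ j *ᵥ S.disturbanceSum P T w (t + j) := by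
    intro j
    induction j with
    | zero => simp
    | succ j ih =>
      intro hj
      rw [ih (by omega), Finset.sum_range_succ, add_assoc]
      congr 1
      by_cases hT : t + j < T
      · rw [disturbanceSum_of_lt hT, exactPrediction, if_pos ⟨by omega, hT⟩, Matrix.mulVec_add,
          Matrix.mulVec_mulVec _ _ (S.closedLoop P)ᵀ, ← pow_succ, add_assoc]
      · rw [disturbanceSum_of_le (by omega), disturbanceSum_of_le (by omega), exactPrediction,
          if_neg (by omega)]
        simp
  simpa [disturbanceSum] using h k le_rfl

/-- The states under the feedback `u = - K x - (R + Bᵀ P B)⁻¹ Bᵀ ψ`. -/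
noncomputable def feedbackStates (S : LQR n m) (P : Matrix (Fin n) (Fin n) ℝ) (x₀ : Fin n → ℝ)
    (ψ w : ℕ → Fin n → ℝ) : ℕ → Fin n → ℝ
  | 0 => x₀
  | t + 1 => S.closedLoop P *ᵥ feedbackStates S P x₀ ψ w t + (-(S.matH P *ᵥ ψ t) + w t)

/-- The control `- K x - (R + Bᵀ P B)⁻¹ Bᵀ ψ`. -/
noncomputable def feedbackControl (S : LQR n m) (P : Matrix (Fin n) (Fin n) ℝ)
    (x ψ : Fin n → ℝ) : Fin m → ℝ :=
  -(S.gain P *ᵥ x) - S.feedforward P *ᵥ ψ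

theorem step_feedbackControl (x ψ w : Fin n → ℝ) :
    S.A *ᵥ x + S.B *ᵥ S.feedbackControl P x ψ + w
      = S.closedLoop P *ᵥ x + (-(S.matH P *ᵥ ψ) + w) := by
  rw [feedbackControl, closedLoop, Matrix.sub_mulVec, Matrix.mulVec_sub, Matrix.mulVec_neg,
    Matrix.mulVec_mulVec, Matrix.mulVec_mulVec, mul_feedforward]
  abel

theorem deviation_feedbackControl (x ψ : Fin n → ℝ) :
    S.deviation P x ψ (S.feedbackControl P x ψ) = 0 := by
  rw [deviation, feedbackControl]
  abel

theorem states_feedbackControl (x₀ : Fin n → ℝ) (ψ w : ℕ → Fin n → ℝ) (t : ℕ) :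
    S.states x₀ (fun t => S.feedbackControl P (S.feedbackStates P x₀ ψ w t) (ψ t)) w t
      = S.feedbackStates P x₀ ψ w t := by
  induction t with
  | zero => rfl
  | succ t ih => rw [states, ih, step_feedbackControl, feedbackStates]

/-- The least cost over the horizon `N` with terminal cost matrix `P`. -/
noncomputable def riccatiOpt (S : LQR n m) (P : Matrix (Fin n) (Fin n) ℝ) (N : ℕ)
    (x₀ : Fin n → ℝ) (w : ℕ → Fin n → ℝ) : ℝ :=
  S.potential P x₀ (S.disturbanceSum P N w 0)
    + ∑ t ∈ Finset.range N, S.disturbanceSum P N w t ⬝ᵥ (S.matM P *ᵥ S.disturbanceSum P N w t)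

theorem IsRiccatiSolution.costWith_eq_riccatiOpt_add (hS : S.Standing)
    (hP : S.IsRiccatiSolution P) (hPinv : IsUnit P.det) {x w : ℕ → Fin n → ℝ}
    {u : ℕ → Fin m → ℝ} {N : ℕ} (hx : ∀ t < N, x (t + 1) = S.A *ᵥ x t + S.B *ᵥ u t + w t) :
    S.costWith P N x u = S.riccatiOpt P N (x 0) w
      + ∑ t ∈ Finset.range N, S.deviation P (x t) (S.disturbanceSum P N w t) (u t) ⬝ᵥ
          (S.gramSig P *ᵥ S.deviation P (x t) (S.disturbanceSum P N w t) (u t)) :=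
  hP.costWith_eq hS hPinv hx (fun _ ht => disturbanceSum_of_lt ht w) (disturbanceSum_of_le le_rfl w)

/-- The window cost is a constant plus Σ-squares of the deviations, and feedback makes all of them
zero. A minimizer must do so too, and Σ ≻ 0 then fixes its first action. For k = 0 the disturbance
sum is empty and the formula reduces to −Kx. -/
theorem IsRiccatiSolution.isMyopicAction_iff (hS : S.Standing) (hP : S.IsRiccatiSolution P)
    (hPinv : IsUnit P.det) (k : ℕ) (x : Fin n → ℝ) (what : ℕ → Fin n → ℝ) (u : Fin m → ℝ) :
    S.IsMyopicAction P k x what u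
      ↔ u = S.feedbackControl P x (S.disturbanceSum P k what 0) := by
  cases k with
  | zero => simp [IsMyopicAction, feedbackControl, disturbanceSum]
  | succ k =>
    have hSig := hS.posDef_gramSig hP.posSemidef
    have hcost : ∀ v, S.costWith P (k + 1) (S.states x v what) v
        = S.riccatiOpt P (k + 1) x what + ∑ t ∈ Finset.range (k + 1),
          S.deviation P (S.states x v what t) (S.disturbanceSum P (k + 1) what t) (v t) ⬝ᵥ
            (S.gramSig P *ᵥ
              S.deviation P (S.states x v what t) (S.disturbanceSum P (k + 1) what t) (v t)) :=
      fun v => hP.costWith_eq_riccatiOpt_add hS hPinv fun t _ => rfl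
    set ψ := S.disturbanceSum P (k + 1) what
    set vs : ℕ → Fin m → ℝ := fun t => S.feedbackControl P (S.feedbackStates P x ψ what t) (ψ t)
      with hvs
    have hopt : S.costWith P (k + 1) (S.states x vs what) vs = S.riccatiOpt P (k + 1) x what := by
      rw [hcost, add_eq_left]
      refine Finset.sum_eq_zero fun t _ => ?_
      rw [hvs, states_feedbackControl, deviation_feedbackControl, zero_dotProduct]
    constructor
    · rintro ⟨v, rfl, hv⟩
      have h := hv vs
      rw [hopt, hcost, add_le_iff_nonpos_right] at h
      have h0 := (Finset.sum_eq_zero_iff_of_nonneg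
        fun t _ => hSig.posSemidef.quadForm_nonneg _).1
        (le_antisymm h (Finset.sum_nonneg fun t _ => hSig.posSemidef.quadForm_nonneg _)) 0
        (Finset.mem_range.2 (Nat.succ_pos k))
      have hd : S.deviation P x (ψ 0) (v 0) = 0 := by
        by_contra hne
        have := hSig.dotProduct_mulVec_pos hne
        rw [star_trivial] at this
        exact this.ne' h0
      rw [deviation] at hd
      rw [feedbackControl, ← sub_eq_zero, ← hd]
      abel
    · rintro rfl
      refine ⟨vs, rfl, fun v' => ?_⟩
      rw [hopt, hcost, le_add_iff_nonneg_right]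
      exact Finset.sum_nonneg fun t _ => hSig.posSemidef.quadForm_nonneg _

theorem IsRiccatiSolution.lambdaMin_mul_sum_le (hS : S.Standing) (hP : S.IsRiccatiSolution P)
    (hPinv : IsUnit P.det) (N : ℕ) (x₀ : Fin n → ℝ) (w : ℕ → Fin n → ℝ) :
    S.ratioDenom P * ∑ t ∈ Finset.range N, euNorm (S.disturbanceSum P N w t) ^ 2
      ≤ S.riccatiOpt P N x₀ w := by
  rw [Finset.mul_sum]
  refine le_trans (Finset.sum_le_sum fun t _ => ?_)
    (le_add_of_nonneg_left (potential_nonneg hP.posSemidef _ _))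
  exact lambdaMin_mul_sq_le (hP.posSemidef_matM hS hPinv) _

theorem IsMyopicRun.control_eq (hS : S.Standing) (hP : S.IsRiccatiSolution P)
    (hPinv : IsUnit P.det) {k T : ℕ} {x₀ : Fin n → ℝ} {w x : ℕ → Fin n → ℝ}
    {u : ℕ → Fin m → ℝ} (h : S.IsMyopicRun P k T x₀ w x u) {t : ℕ} (ht : t < T) :
    u t = S.feedbackControl P (x t) (S.disturbanceSum P k (exactPrediction k T w t) 0) :=
  (hP.isMyopicAction_iff hS hPinv _ _ _ _).1 (h.action t ht)

theorem sum_range_shift_le {f : ℕ → ℝ} (hf : ∀ t, 0 ≤ f t) {T : ℕ} (h0 : ∀ t, T ≤ t → f t = 0)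
    (k : ℕ) : ∑ t ∈ Finset.range T, f (t + k) ≤ ∑ t ∈ Finset.range T, f t := by
  calc ∑ t ∈ Finset.range T, f (t + k) ≤ ∑ t ∈ Finset.range (T + k), f t := by
        rw [add_comm T k, Finset.sum_range_add]
        simp only [add_comm k]
        exact le_add_of_nonneg_left (Finset.sum_nonneg fun t _ => hf t)
    _ = ∑ t ∈ Finset.range T, f t := by
        rw [Finset.sum_range_add]
        simp [h0]

theorem IsRiccatiSolution.ratioDenom_pos (hS : S.Standing) (hP : S.IsRiccatiSolution P)
    (hPinv : IsUnit P.det) (hden : S.ratioDenom P ≠ 0) : 0 < S.ratioDenom P :=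
  (lambdaMin_nonneg (hP.posSemidef_matM hS hPinv)).lt_of_ne' hden

/-- The competitive ratio bound for the terminal cost matrix `P`. -/
theorem IsMyopicRun.costWith_le (hS : S.Standing) (hP : S.IsRiccatiSolution P)
    (hPinv : IsUnit P.det) (hden : S.ratioDenom P ≠ 0) {k T : ℕ} {x₀ : Fin n → ℝ}
    {w x : ℕ → Fin n → ℝ} {u : ℕ → Fin m → ℝ} (h : S.IsMyopicRun P k T x₀ w x u) :
    S.costWith P T x u ≤ (1 + S.ratioExcess P k) * S.riccatiOpt P T x₀ w := by
  have hlam := hP.ratioDenom_pos hS hPinv hden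
  set ψ := S.disturbanceSum P T w with hψ
  set c := ‖S.closedLoop P ^ k‖ ^ 2 * ‖S.matH P‖ with hc
  have hterm : ∀ t < T, S.deviation P (x t) (ψ t) (u t) ⬝ᵥ
      (S.gramSig P *ᵥ S.deviation P (x t) (ψ t) (u t)) ≤ c * euNorm (ψ (t + k)) ^ 2 := by
    intro t ht
    set z := (S.closedLoop P)ᵀ ^ k *ᵥ ψ (t + k) with hz
    -- The predicted part of ψ_t cancels against the policy's own feedforward; only the unseen tail
    -- remains.
    have hd : S.deviation P (x t) (ψ t) (u t) = S.feedforward P *ᵥ z := by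
      rw [h.control_eq hS hP hPinv ht, hψ, disturbanceSum_eq_add k T w t, deviation,
        feedbackControl, Matrix.mulVec_add]
      abel
    have hzn : euNorm z ≤ ‖S.closedLoop P ^ k‖ * euNorm (ψ (t + k)) := by
      refine (euNorm_mulVec_le _ _).trans_eq ?_
      rw [← Matrix.transpose_pow, norm_transpose]
    rw [hd, Matrix.mulVec_mulVec _ (S.gramSig P), hS.gramSig_mul_feedforward hP.posSemidef,
      dotProduct_comm, mulVec_dotProduct, Matrix.transpose_transpose,
      Matrix.mulVec_mulVec _ S.B, mul_feedforward]
    calc z ⬝ᵥ (S.matH P *ᵥ z) ≤ ‖S.matH P‖ * euNorm z * euNorm z :=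
          (le_abs_self _).trans (abs_dotProduct_mulVec_le _ _ _)
      _ = ‖S.matH P‖ * euNorm z ^ 2 := by ring
      _ ≤ ‖S.matH P‖ * (‖S.closedLoop P ^ k‖ * euNorm (ψ (t + k))) ^ 2 := by
          gcongr
          exact euNorm_nonneg z
      _ = _ := by rw [hc]; ring
  have hsum : ∑ t ∈ Finset.range T, S.deviation P (x t) (ψ t) (u t) ⬝ᵥ
      (S.gramSig P *ᵥ S.deviation P (x t) (ψ t) (u t))
      ≤ c * ∑ t ∈ Finset.range T, euNorm (ψ t) ^ 2 := by
    refine (Finset.sum_le_sum fun t ht => hterm t (Finset.mem_range.1 ht)).trans ?_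
    rw [← Finset.mul_sum]
    refine mul_le_mul_of_nonneg_left ?_ (by positivity)
    -- ψ vanishes from T on, so shifting the index by k cannot increase the sum.
    refine sum_range_shift_le (f := fun t => euNorm (ψ t) ^ 2) (fun t => by positivity)
      (fun t ht => ?_) k
    simp [hψ, disturbanceSum_of_le ht, euNorm_zero]
  have hlow := hP.lambdaMin_mul_sum_le hS hPinv T x₀ w
  have hcost := hP.costWith_eq_riccatiOpt_add hS hPinv h.step
  rw [h.init] at hcost
  have hex : c * ∑ t ∈ Finset.range T, euNorm (ψ t) ^ 2
      ≤ S.ratioExcess P k * S.riccatiOpt P T x₀ w := by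
    rw [ratioExcess, ← hc, div_mul_eq_mul_div, le_div_iff₀ hlam, mul_assoc]
    refine mul_le_mul_of_nonneg_left ?_ (by positivity)
    rw [mul_comm]
    exact hlow
  linarith

end LQR

/-! ### Detectability, stability of the closed loop, and general terminal costs -/

namespace LQR

variable {n m : ℕ} {S : LQR n m} {P : Matrix (Fin n) (Fin n) ℝ}

theorem Standing.stageCost_nonneg (hS : S.Standing) (x : Fin n → ℝ) (u : Fin m → ℝ) :
    0 ≤ x ⬝ᵥ (S.Q *ᵥ x) + u ⬝ᵥ (S.R *ᵥ u) :=
  add_nonneg (hS.posSemidef_Q.quadForm_nonneg x) (hS.posDef_R.posSemidef.quadForm_nonneg u)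

/-- Output injection: `A x + B u` is an exponentially stable matrix applied to `x`, up to a term
that is controlled by the stage cost. -/
theorem Standing.exists_detector (hS : S.Standing) :
    ∃ (G D : Matrix (Fin n) (Fin n) ℝ) (c ρ C : ℝ), 0 ≤ c ∧ 0 < ρ ∧ ρ < 1 ∧ 0 ≤ C ∧
      (∀ k, ‖G ^ k‖ ≤ c * ρ ^ k) ∧
      (∀ x u, S.A *ᵥ x + S.B *ᵥ u = G *ᵥ x + (D *ᵥ (S.Q *ᵥ x) + S.B *ᵥ u)) ∧
      ∀ x u, euNorm (D *ᵥ (S.Q *ᵥ x) + S.B *ᵥ u) ^ 2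
        ≤ C * (x ⬝ᵥ (S.Q *ᵥ x) + u ⬝ᵥ (S.R *ᵥ u)) := by
  obtain ⟨L, hL⟩ := hS.stabilizable_transpose
  obtain ⟨c, ρ, hc, h0, h1, hpow⟩ := exists_norm_pow_le_of_realSpectralRadius_lt_one hL
  obtain ⟨c₁, hc₁, hQ⟩ := euNorm_mulVec_sq_le hS.posSemidef_Q
  obtain ⟨c₂, hc₂, hR⟩ := euNorm_mulVec_sq_le hS.posDef_R.posSemidef
  -- G is the transpose of the stable matrix Aᵀ − QL. The factors 2 come from (a + b)² ≤ 2a² + 2b²,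
  -- and Bu is controlled through Bu = BR⁻¹(Ru).
  refine ⟨S.A - Lᵀ * S.Q, Lᵀ, c, ρ, 2 * ‖Lᵀ‖ ^ 2 * c₁ + 2 * (‖S.B‖ * ‖S.R⁻¹‖) ^ 2 * c₂, hc, h0, h1,
    by positivity, fun k => ?_, fun x u => ?_, fun x u => ?_⟩
  · rw [← norm_transpose, Matrix.transpose_pow, Matrix.transpose_sub, Matrix.transpose_mul,
      Matrix.transpose_transpose, hS.posSemidef_Q.transpose_eq]
    exact hpow k
  · rw [Matrix.sub_mulVec, Matrix.mulVec_mulVec]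
    abel
  · have hu : S.B *ᵥ u = S.B *ᵥ (S.R⁻¹ *ᵥ (S.R *ᵥ u)) := by
      rw [Matrix.mulVec_mulVec _ S.R⁻¹, Matrix.nonsing_inv_mul _
        ((Matrix.isUnit_iff_isUnit_det _).1 hS.posDef_R.isUnit), Matrix.one_mulVec]
    have hb : euNorm (S.B *ᵥ u) ≤ ‖S.B‖ * ‖S.R⁻¹‖ * euNorm (S.R *ᵥ u) := by
      rw [hu, mul_assoc]
      exact (euNorm_mulVec_le _ _).trans
        (mul_le_mul_of_nonneg_left (euNorm_mulVec_le _ _) (norm_nonneg _))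
    have ha := euNorm_mulVec_le Lᵀ (S.Q *ᵥ x)
    have hq := hS.posSemidef_Q.quadForm_nonneg x
    have hr := hS.posDef_R.posSemidef.quadForm_nonneg u
    have ha2 := (pow_le_pow_left₀ (euNorm_nonneg _) ha 2).trans
      ((mul_pow _ _ 2).le.trans (mul_le_mul_of_nonneg_left (hQ x) (by positivity)))
    have hb2 := (pow_le_pow_left₀ (euNorm_nonneg _) hb 2).trans
      ((mul_pow _ _ 2).le.trans (mul_le_mul_of_nonneg_left (hR u) (by positivity)))
    have hab := (pow_le_pow_left₀ (euNorm_nonneg _)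
      (euNorm_add_le (Lᵀ *ᵥ (S.Q *ᵥ x)) (S.B *ᵥ u)) 2).trans add_sq_le
    have h3 : 0 ≤ 2 * ‖Lᵀ‖ ^ 2 * c₁ * (u ⬝ᵥ (S.R *ᵥ u)) := by positivity
    have h4 : 0 ≤ 2 * (‖S.B‖ * ‖S.R⁻¹‖) ^ 2 * c₂ * (x ⬝ᵥ (S.Q *ᵥ x)) := by positivity
    linarith

/-- The cost without disturbances. -/
theorem IsRiccatiSolution.costWith_eq_of_no_disturbance (hS : S.Standing)
    (hP : S.IsRiccatiSolution P) (hPinv : IsUnit P.det) {x : ℕ → Fin n → ℝ} {u : ℕ → Fin m → ℝ}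
    {N : ℕ} (hx : ∀ t < N, x (t + 1) = S.A *ᵥ x t + S.B *ᵥ u t) :
    S.costWith P N x u = S.potential P (x 0) 0
      + ∑ t ∈ Finset.range N, S.deviation P (x t) 0 (u t) ⬝ᵥ
          (S.gramSig P *ᵥ S.deviation P (x t) 0 (u t)) := by
  have h := hP.costWith_eq hS hPinv (x := x) (w := 0) (ψ := 0) (u := u) (N := N)
    (fun t ht => by simp [hx t ht]) (fun t _ => by simp) rfl
  simpa using h

/-- The closed loop is exponentially stable. -/
theorem IsRiccatiSolution.exists_norm_closedLoop_pow_le (hS : S.Standing)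
    (hP : S.IsRiccatiSolution P) (hPinv : IsUnit P.det) :
    ∃ c ρ : ℝ, 0 ≤ c ∧ 0 < ρ ∧ ρ < 1 ∧ ∀ k, ‖S.closedLoop P ^ k‖ ≤ c * ρ ^ k := by
  obtain ⟨G, D, c, ρ, C, hc, h0, h1, hC, hG, hstep, hbd⟩ := hS.exists_detector
  refine exists_norm_pow_le_of_realSpectralRadius_lt_one
    (realSpectralRadius_lt_one_of_tendsto fun x₀ => ?_)
  set e : ℕ → Fin n → ℝ := fun t => S.closedLoop P ^ t *ᵥ x₀ with he
  set v : ℕ → Fin m → ℝ := fun t => -(S.gain P *ᵥ e t) with hv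
  have hev : ∀ t, e (t + 1) = S.A *ᵥ e t + S.B *ᵥ v t := by
    intro t
    rw [closedLoop_mulVec_add (P := P), hv, neg_add_cancel, Matrix.mulVec_zero, add_zero, he,
      Matrix.mulVec_mulVec, ← pow_succ']
  -- Under u = −Kx the deviation is zero, so the potential at the start bounds all partial sums. The
  -- stage costs hence tend to 0, and the detector passes this on to the states.
  have hsum : Summable fun t => e t ⬝ᵥ (S.Q *ᵥ e t) + v t ⬝ᵥ (S.R *ᵥ v t) := by
    refine summable_of_sum_range_le (c := S.potential P (e 0) 0)
      (fun t => hS.stageCost_nonneg _ _) fun N => ?_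
    have h := hP.costWith_eq_of_no_disturbance hS hPinv (N := N) fun t _ => hev t
    have hd : ∀ t, S.deviation P (e t) 0 (v t) = 0 := fun t => by simp [deviation, hv]
    simp only [hd, zero_dotProduct, Finset.sum_const_zero, add_zero, costWith] at h
    have := hP.posSemidef.quadForm_nonneg (e N)
    linarith
  have hlim : Filter.Tendsto (fun t => euNorm (D *ᵥ (S.Q *ᵥ e t) + S.B *ᵥ v t)) Filter.atTop
      (nhds 0) := by
    have h2 : Filter.Tendsto (fun t => euNorm (D *ᵥ (S.Q *ᵥ e t) + S.B *ᵥ v t) ^ 2) Filter.atTop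
        (nhds 0) := by
      refine squeeze_zero (fun t => by positivity) (fun t => hbd (e t) (v t)) ?_
      simpa using hsum.tendsto_atTop_zero.const_mul C
    have h3 := h2.sqrt
    simp only [Real.sqrt_zero] at h3
    exact h3.congr fun t => Real.sqrt_sq (euNorm_nonneg _)
  have hlim2 := tendsto_affine_recursion hc h0 h1 hG (fun t => (hev t).trans (hstep _ _)) hlim
  have h5 : Filter.Tendsto (fun t => WithLp.toLp 2 (e t)) Filter.atTop (nhds 0) :=
    tendsto_zero_iff_norm_tendsto_zero.2 hlim2
  have h6 := ((PiLp.continuous_ofLp 2 fun _ : Fin n => ℝ).tendsto 0).comp h5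
  simpa [Function.comp_def] using h6

/-- Along undisturbed trajectories from the origin, the stage costs control the final state. -/
theorem Standing.exists_euNorm_sq_le_stageCost (hS : S.Standing) :
    ∃ C : ℝ, 0 ≤ C ∧ ∀ (N : ℕ) (e : ℕ → Fin n → ℝ) (v : ℕ → Fin m → ℝ), e 0 = 0 →
      (∀ t < N, e (t + 1) = S.A *ᵥ e t + S.B *ᵥ v t) →
      euNorm (e N) ^ 2
        ≤ C * ∑ t ∈ Finset.range N, (e t ⬝ᵥ (S.Q *ᵥ e t) + v t ⬝ᵥ (S.R *ᵥ v t)) := by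
  obtain ⟨G, D, c, ρ, C, hc, h0, h1, hC, hG, hstep, hbd⟩ := hS.exists_detector
  have hρ : 0 < 1 - ρ := sub_pos.2 h1
  refine ⟨c ^ 2 * (1 - ρ)⁻¹ * C, by positivity, fun N e v he hev => ?_⟩
  refine (euNorm_affine_recursion_sq_le h0 h1 hG
    (fun t ht => (hev t ht).trans (hstep _ _)) he).trans ?_
  rw [mul_assoc _ C, Finset.mul_sum _ _ C]
  gcongr with t ht
  exact hbd _ _

section Bounds

variable {c ρ r : ℝ}

theorem euNorm_disturbanceSum_le (hc : 0 ≤ c) (h0 : 0 < ρ) (h1 : ρ < 1)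
    (hF : ∀ k, ‖S.closedLoop P ^ k‖ ≤ c * ρ ^ k) (hr : 0 ≤ r) {N t : ℕ} {w : ℕ → Fin n → ℝ}
    (hw : ∀ i < N - t, euNorm (w (t + i)) ≤ r) :
    euNorm (S.disturbanceSum P N w t) ≤ c * (‖P‖ * r) * (1 - ρ)⁻¹ := by
  refine euNorm_sum_pow_mulVec_le hc h0 h1 (fun k => ?_) (by positivity) fun j hj => ?_
  · rw [← Matrix.transpose_pow, norm_transpose]
    exact hF k
  · exact (euNorm_mulVec_le _ _).trans (mul_le_mul_of_nonneg_left (hw j hj) (norm_nonneg _))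

/-- Feedback trajectories with bounded disturbances and bounded feedforward terms are bounded. -/
theorem euNorm_feedback_le (hc : 0 ≤ c) (h0 : 0 < ρ) (h1 : ρ < 1)
    (hF : ∀ k, ‖S.closedLoop P ^ k‖ ≤ c * ρ ^ k) (hr : 0 ≤ r) {b : ℝ} (hb : 0 ≤ b) {N : ℕ}
    {x w φ : ℕ → Fin n → ℝ} (hw : ∀ t < N, euNorm (w t) ≤ r) (hφ : ∀ t < N, euNorm (φ t) ≤ b)
    (hx : ∀ t < N, x (t + 1) = S.closedLoop P *ᵥ x t + (-(S.matH P *ᵥ φ t) + w t)) :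
    euNorm (x N) ≤ c * euNorm (x 0) + c * (‖S.matH P‖ * b + r) * (1 - ρ)⁻¹ := by
  refine euNorm_affine_recursion_le hc h0 h1 hF (by positivity) hx fun t ht => ?_
  refine (euNorm_add_le _ _).trans (add_le_add ?_ (hw t ht))
  rw [euNorm_neg]
  exact (euNorm_mulVec_le _ _).trans (mul_le_mul_of_nonneg_left (hφ t ht) (norm_nonneg _))

end Bounds

/-- The states that the myopic policies and the optimal policy for the terminal cost matrix `P`
reach are bounded uniformly in the horizon, the number of predictions and the disturbances. -/
theorem IsRiccatiSolution.exists_state_bound (hS : S.Standing) (hP : S.IsRiccatiSolution P)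
    (hPinv : IsUnit P.det) (x₀ : Fin n → ℝ) (r : ℝ) :
    ∃ X : ℝ, 0 ≤ X ∧ ∀ (T : ℕ) (w : ℕ → Fin n → ℝ), (∀ t < T, euNorm (w t) ≤ r) →
      euNorm (S.feedbackStates P x₀ (S.disturbanceSum P T w) w T) ≤ X ∧
      ∀ (k : ℕ) (x : ℕ → Fin n → ℝ) (u : ℕ → Fin m → ℝ),
        S.IsMyopicRun P k T x₀ w x u → euNorm (x T) ≤ X := by
  obtain ⟨c, ρ, hc, h0, h1, hF⟩ := hP.exists_norm_closedLoop_pow_le hS hPinv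
  have hρ : 0 < 1 - ρ := sub_pos.2 h1
  have hx₀ := euNorm_nonneg x₀
  have hr := abs_nonneg r
  have hb : 0 ≤ c * (‖P‖ * |r|) * (1 - ρ)⁻¹ := by positivity
  -- `|r|` keeps the bound nonnegative when r < 0, in which case only T = 0 is possible.
  refine ⟨c * euNorm x₀ + c * (‖S.matH P‖ * (c * (‖P‖ * |r|) * (1 - ρ)⁻¹) + |r|) * (1 - ρ)⁻¹,
    by positivity, fun T w hw => ?_⟩
  have hw' : ∀ t < T, euNorm (w t) ≤ |r| := fun t ht => (hw t ht).trans (le_abs_self r)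
  refine ⟨?_, fun k x u h => ?_⟩
  · refine euNorm_feedback_le hc h0 h1 hF hr hb
      (x := S.feedbackStates P x₀ (S.disturbanceSum P T w) w) (φ := S.disturbanceSum P T w) hw'
      (fun t _ => ?_) fun t _ => rfl
    exact euNorm_disturbanceSum_le hc h0 h1 hF hr fun i hi => hw' _ (by omega)
  · rw [← h.init]
    refine euNorm_feedback_le hc h0 h1 hF hr hb
      (φ := fun t => S.disturbanceSum P k (exactPrediction k T w t) 0) hw' (fun t _ => ?_)
      fun t ht => ?_
    · refine euNorm_disturbanceSum_le hc h0 h1 hF hr fun i _ => ?_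
      rw [exactPrediction]
      split_ifs with hi
      · exact hw' _ (by omega)
      · rw [euNorm_zero]
        exact hr
    · rw [h.step t ht, h.control_eq hS hP hPinv ht, step_feedbackControl]

theorem costWith_eq_add (E E' : Matrix (Fin n) (Fin n) ℝ) (N : ℕ) (x : ℕ → Fin n → ℝ)
    (u : ℕ → Fin m → ℝ) :
    S.costWith E N x u = S.costWith E' N x u + x N ⬝ᵥ ((E - E') *ᵥ x N) := by
  rw [costWith, costWith, Matrix.sub_mulVec, dotProduct_sub]
  ring

/-- The terminal cost matrix changes the least cost by at most a constant. -/
theorem IsRiccatiSolution.exists_riccatiOpt_le_cost_add (hS : S.Standing)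
    (hP : S.IsRiccatiSolution P) (hPinv : IsUnit P.det) (x₀ : Fin n → ℝ) (r : ℝ) :
    ∃ κ : ℝ, ∀ (T : ℕ) (w : ℕ → Fin n → ℝ), (∀ t < T, euNorm (w t) ≤ r) →
      ∀ u, S.riccatiOpt P T x₀ w ≤ S.cost T (S.states x₀ u w) u + κ := by
  obtain ⟨X, hX, hbound⟩ := hP.exists_state_bound hS hPinv x₀ r
  obtain ⟨C, hC, hdet⟩ := hS.exists_euNorm_sq_le_stageCost
  set q := ‖S.Qf - P‖
  refine ⟨(q * X) ^ 2 * C + q * X * X, fun T w hw u => ?_⟩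
  set ψ := S.disturbanceSum P T w with hψ
  set z := S.feedbackStates P x₀ ψ w with hz
  set x := S.states x₀ u w with hx
  -- Compare with the P-optimal trajectory z. The difference is undisturbed, starts at 0 and has the
  -- same deviations as x, since those of z vanish. The excess of x over the optimum is then the
  -- P-terminal cost of e.
  set e : ℕ → Fin n → ℝ := fun t => x t - z t with he
  set v : ℕ → Fin m → ℝ := fun t => u t - S.feedbackControl P (z t) (ψ t) with hv
  have he0 : e 0 = 0 := sub_self x₀
  have hes : ∀ t, e (t + 1) = S.A *ᵥ e t + S.B *ᵥ v t := by
    intro t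
    have h1 : x (t + 1) = S.A *ᵥ x t + S.B *ᵥ u t + w t := rfl
    have h2 : z (t + 1) = S.A *ᵥ z t + S.B *ᵥ S.feedbackControl P (z t) (ψ t) + w t :=
      (step_feedbackControl _ _ _).symm
    simp only [he, hv, h1, h2, Matrix.mulVec_sub]
    abel
  have hdev : ∀ t, S.deviation P (x t) (ψ t) (u t) = S.deviation P (e t) 0 (v t) := by
    intro t
    simp only [deviation, he, hv, feedbackControl, Matrix.mulVec_sub, Matrix.mulVec_zero]
    abel
  have hcx := hP.costWith_eq_riccatiOpt_add hS hPinv (x := x) (u := u) (w := w) (N := T)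
    fun t _ => rfl
  have hce := hP.costWith_eq_of_no_disturbance hS hPinv (N := T) fun t _ => hes t
  have hpot : S.potential P (e 0) 0 = 0 := by simp [he0, potential]
  rw [hpot, zero_add] at hce
  simp only [← hψ, hdev] at hcx
  rw [← hce, show x 0 = x₀ from rfl] at hcx
  have hQt : (S.Qf - P)ᵀ = S.Qf - P := by
    rw [Matrix.transpose_sub, hS.posSemidef_Qf.transpose_eq, hP.posSemidef.transpose_eq]
  have hxT : x T = z T + e T := (add_sub_cancel (z T) (x T)).symm
  have hcost : S.cost T x u = S.riccatiOpt P T x₀ w + S.costWith S.Qf T e v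
      + z T ⬝ᵥ ((S.Qf - P) *ᵥ z T) + 2 * (z T ⬝ᵥ ((S.Qf - P) *ᵥ e T)) := by
    have h1 := costWith_eq_add (S := S) S.Qf P T x u
    have h2 := costWith_eq_add (S := S) S.Qf P T e v
    rw [hxT, quadForm_add hQt] at h1
    rw [cost]
    linarith
  have hzX := (hbound T w hw).1
  rw [← hψ, ← hz] at hzX
  have hz0 := euNorm_nonneg (z T)
  have he0' := euNorm_nonneg (e T)
  have b1 : -(q * X * X) ≤ z T ⬝ᵥ ((S.Qf - P) *ᵥ z T) := by
    refine neg_le_of_abs_le ((abs_dotProduct_mulVec_le _ _ _).trans ?_)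
    gcongr
  have b2 : -(q * X * euNorm (e T)) ≤ z T ⬝ᵥ ((S.Qf - P) *ᵥ e T) := by
    refine neg_le_of_abs_le ((abs_dotProduct_mulVec_le _ _ _).trans ?_)
    gcongr
  have b3 := hdet T e v he0 fun t _ => hes t
  set s := ∑ t ∈ Finset.range T, (e t ⬝ᵥ (S.Q *ᵥ e t) + v t ⬝ᵥ (S.R *ᵥ v t)) with hs
  have hs0 : 0 ≤ s := Finset.sum_nonneg fun t _ => hS.stageCost_nonneg _ _
  have b4 : s ≤ S.costWith S.Qf T e v := by
    rw [costWith, ← hs]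
    exact le_add_of_nonneg_right (hS.posSemidef_Qf.quadForm_nonneg _)
  -- ‖e_T‖² ≤ C s, so AM–GM lets the stage cost s absorb the only term that is linear in e_T.
  have b5 : 2 * (q * X * euNorm (e T)) ≤ s + (q * X) ^ 2 * C := by
    have hqX : 0 ≤ q * X := mul_nonneg (norm_nonneg _) hX
    refine abs_le_of_sq_le_sq' ?_ (by positivity) |>.2
    have h1 : (q * X) ^ 2 * euNorm (e T) ^ 2 ≤ (q * X) ^ 2 * (C * s) := by gcongr
    nlinarith [sq_nonneg (s - (q * X) ^ 2 * C)]
  linarith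

/-- The excess of the competitive ratio decays exponentially. -/
theorem IsRiccatiSolution.exists_ratioExcess_le (hS : S.Standing) (hP : S.IsRiccatiSolution P)
    (hPinv : IsUnit P.det) (hden : S.ratioDenom P ≠ 0) :
    ∃ C q : ℝ, 0 < q ∧ q < 1 ∧
      ∀ k : ℕ, 0 ≤ S.ratioExcess P k ∧ S.ratioExcess P k ≤ C * q ^ k := by
  obtain ⟨c, ρ, hc, h0, h1, hF⟩ := hP.exists_norm_closedLoop_pow_le hS hPinv
  have hlam := hP.ratioDenom_pos hS hPinv hden
  refine ⟨c ^ 2 * ‖S.matH P‖ / S.ratioDenom P, ρ ^ 2, by positivity,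
    pow_lt_one₀ h0.le h1 two_ne_zero, fun k => ⟨by unfold ratioExcess; positivity, ?_⟩⟩
  rw [ratioExcess, div_mul_eq_mul_div]
  refine div_le_div_of_nonneg_right ?_ hlam.le
  calc ‖S.closedLoop P ^ k‖ ^ 2 * ‖S.matH P‖ ≤ (c * ρ ^ k) ^ 2 * ‖S.matH P‖ := by
        gcongr
        exact hF k
    _ = c ^ 2 * ‖S.matH P‖ * (ρ ^ 2) ^ k := by ring

/-- The competitive ratio bound. -/
theorem IsRiccatiSolution.exists_competitive_bound (hS : S.Standing) (hP : S.IsRiccatiSolution P)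
    (hPinv : IsUnit P.det) (hden : S.ratioDenom P ≠ 0) (x₀ : Fin n → ℝ) (r : ℝ) :
    ∃ κ : ℝ, (S.Qf = P → κ = 0) ∧
      ∀ (k T : ℕ) (w x : ℕ → Fin n → ℝ) (u : ℕ → Fin m → ℝ),
        (∀ t < T, euNorm (w t) ≤ r) → S.IsMyopicRun P k T x₀ w x u →
        S.cost T x u ≤ (1 + S.ratioExcess P k) * S.opt T x₀ w + κ := by
  obtain ⟨C, q, hq0, hq1, hex⟩ := hP.exists_ratioExcess_le hS hPinv hden
  by_cases hQf : S.Qf = P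
  · refine ⟨0, fun _ => rfl, fun k T w x u _ h => ?_⟩
    rw [add_zero, cost, hQf]
    refine (h.costWith_le hS hP hPinv hden).trans
      (mul_le_mul_of_nonneg_left (le_ciInf fun v => ?_) (by linarith [(hex k).1]))
    rw [cost, hQf, hP.costWith_eq_riccatiOpt_add hS hPinv (w := w) fun t _ => rfl]
    exact le_add_of_nonneg_right (Finset.sum_nonneg fun t _ =>
      (hS.posDef_gramSig hP.posSemidef).posSemidef.quadForm_nonneg _)
  · obtain ⟨X, hX, hbound⟩ := hP.exists_state_bound hS hPinv x₀ r
    obtain ⟨κ, hκ⟩ := hP.exists_riccatiOpt_le_cost_add hS hPinv x₀ r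
    -- (1 + C)|κ| pays for replacing the P-optimum by the true one, uniformly in k as the excess
    -- never exceeds C; the other term bounds the change of terminal cost along the myopic run.
    refine ⟨(1 + C) * |κ| + ‖S.Qf - P‖ * X * X, fun h => absurd h hQf,
      fun k T w x u hw h => ?_⟩
    have hexk : S.ratioExcess P k ≤ C := by
      refine (hex k).2.trans (mul_le_of_le_one_right ?_ (pow_le_one₀ hq0.le hq1.le))
      simpa using (hex 0).1.trans (hex 0).2
    have hopt : S.riccatiOpt P T x₀ w ≤ S.opt T x₀ w + |κ| := by
      rw [← sub_le_iff_le_add]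
      refine le_ciInf fun v => ?_
      have h1 := hκ T w hw v
      have h2 := le_abs_self κ
      linarith
    have hterm : x T ⬝ᵥ ((S.Qf - P) *ᵥ x T) ≤ ‖S.Qf - P‖ * X * X := by
      have h1 := (hbound T w hw).2 k x u h
      have h2 := euNorm_nonneg (x T)
      refine ((le_abs_self _).trans (abs_dotProduct_mulVec_le _ _ _)).trans ?_
      gcongr
    have hmain := h.costWith_le hS hP hPinv hden
    have h3 := mul_le_mul_of_nonneg_left hopt
      (show (0 : ℝ) ≤ 1 + S.ratioExcess P k by linarith [(hex k).1])
    have h4 : S.ratioExcess P k * |κ| ≤ C * |κ| := by gcongr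
    rw [cost, costWith_eq_add S.Qf P]
    linarith

end LQR

theorem mainTheorem3 {n m : ℕ} (S : LQR n m) (hS : S.Standing)
    (P : Matrix (Fin n) (Fin n) ℝ) (hP : S.IsRiccatiSolution P)
    (hPinv : IsUnit P.det) (hden : S.ratioDenom P ≠ 0)
    (x₀ : Fin n → ℝ) (r : ℝ) :
    -- the myopic policy is well defined
    (∀ (k : ℕ) (x : Fin n → ℝ) (what : ℕ → Fin n → ℝ),
      ∃! u : Fin m → ℝ, S.IsMyopicAction P k x what u) ∧
    -- the competitive ratio bound
    (∃ κ : ℝ, (S.Qf = P → κ = 0) ∧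
      ∀ (k T : ℕ) (w : ℕ → Fin n → ℝ) (x : ℕ → Fin n → ℝ) (u : ℕ → Fin m → ℝ),
        (∀ t < T, ‖WithLp.toLp 2 (w t)‖ ≤ r) →
        S.IsMyopicRun P k T x₀ w x u →
        S.cost T x u ≤ (1 + S.ratioExcess P k) * S.opt T x₀ w + κ) ∧
    -- exponential decay in the number of predictions
    (∃ C q : ℝ, 0 < q ∧ q < 1 ∧
      ∀ k : ℕ, 0 ≤ S.ratioExcess P k ∧ S.ratioExcess P k ≤ C * q ^ k) := by
  refine ⟨fun k x what => ?_, hP.exists_competitive_bound hS hPinv hden x₀ r,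
    hP.exists_ratioExcess_le hS hPinv hden⟩
  exact ⟨_, (hP.isMyopicAction_iff hS hPinv k x what _).2 rfl,
    fun u hu => (hP.isMyopicAction_iff hS hPinv k x what u).1 hu⟩
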